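/- \textbf{Setting.} Let $0<r<1/2$ and $0<2\omega<1-2r$. Let $\phi_j$, $j\ge 1$, be an orthonormal system in the real space $L_2(0,1)$ with norm $\|\cdot\|$. For a signal $S\in L_2(0,1)$ observed in Gaussian white noise of level $\varepsilon>0$, put $y_j=\theta_j+\varepsilon\xi_j$, $j\ge1$, where $\theta_j=\int_0^1 S\phi_j\,dt$ and the $\xi_j$ are independent standard normal variables. Let $\varkappa_{\varepsilon j}^2\ge 0$ ($\varepsilon>0$, $j\ge1$) be weights with $\rho_\varepsilon^2=\sum_j\varkappa_{\varepsilon j}^2<\infty$, and put $$A_\varepsilon=\varepsilon^{-4}\sum_{j\ge1}\varkappa_{\varepsilon j}^4,\quad k_\varepsilon=\sup\Bigl\{k:\sum_{j<k}\varkappa_{\varepsilon j}^2\le \tfrac12\rho_\varepsilon^2\Bigr\},\quad \varkappa_\varepsilon^2=\varkappa_{\varepsilon k_\varepsilon}^2 .$$ Relations $\asymp$ between functions of $\varepsilon$ are meant as $\varepsilon\to0$, those between sequences as $i\to\infty$, and $[a]$ is the integer part of $a$. Assume $k_\varepsilon\asymp\varepsilon^{-4+8r+4\omega}$ and: A1.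 For every $\varepsilon>0$ the sequence $\varkappa_{\varepsilon j}^2$, $j\ge 1$, is decreasing (not necessarily strictly). A2. There are constants $0<C_1<C_2$ with $C_1<A_\varepsilon<C_2$ for all $\varepsilon>0$. A3. There are $C_1>0$ and $\lambda>1$ such that $\varkappa^2_{\varepsilon,[(1+\delta)k_\varepsilon]}<C_1(1+\delta)^{-\lambda}\varkappa_\varepsilon^2$ for all $\delta>0$ and $\varepsilon>0$. A4. $\varkappa_{\varepsilon1}^2\asymp\varkappa_\varepsilon^2$; and for every $c>1$ there is $C>0$ with $\varkappa^2_{\varepsilon,[ck_\varepsilon]}\ge C\varkappa_\varepsilon^2$ for all $\varepsilon>0$. \textbf{Tests.} Consider the statistic $T_\varepsilon=\varepsilon^{-2}\sum_{j}\varkappa_{\varepsilon j}^2y_j^2-\rho_\varepsilon^2$ and the tests $L_\varepsilon=\mathbf 1\{A_\varepsilon^{-1/2}T_\varepsilon>x_\varepsilon\}$ with real critical values $x_\varepsilon$. Let $\alpha(L_\varepsilon)=\mathbf E_0L_\varepsilon$ and $\beta(L_\varepsilon,S)=\mathbf E_S(1-L_\varepsilon)$ be the error probabilities. \textbf{Definitions.}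 A family of alternatives $S_\varepsilon\in L_2(0,1)$, $\varepsilon>0$, is \emph{$\varepsilon^{-2\omega}$-LD consistent} if for all such tests with $\varepsilon^{4\omega}\log\alpha(L_\varepsilon)\to0$ as $\varepsilon\to 0$ there is $c>0$ with $|\log\beta(L_\varepsilon,S_\varepsilon)|\ge c\,\varepsilon^{-4\omega}$ for all sufficiently small $\varepsilon$ (where $|\log 0|=\infty$). For a sequence of alternatives $S_{1\varepsilon_i}$ at noise levels $\varepsilon_i>0$, $\varepsilon_i\to0$, consistency is defined in the same way, with tests $L_{\varepsilon_i}$ and the limit $i\to\infty$; the sequence is \emph{LD-inconsistent} if none of its subsequences is $\varepsilon^{-2\omega}$-LD consistent. A family $S_\varepsilon$ with $\|S_\varepsilon\|\asymp\varepsilon^{2r}$ is \emph{purely $\varepsilon^{-2\omega}$-LD consistent} if it is $\varepsilon^{-2\omega}$-LD consistent and there are no $c_1>0$, $\varepsilon_i\to0$ ($\varepsilon_i>0$) and LD-inconsistent sequence $S_{1\varepsilon_i}$ such that, for all $i$, $S_{1\varepsilon_i}$ is orthogonal to $S_{\varepsilon_i}-S_{1\varepsilon_i}$ and $\|S_{1\varepsilon_i}\|>c_1\varepsilon_i^{2r}$.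 \textbf{Theorem.} Let $S_\varepsilon\in L_2(0,1)$, $\varepsilon>0$, satisfy $\|S_\varepsilon\|\asymp\varepsilon^{2r}$. Then the family $S_\varepsilon$ is purely $\varepsilon^{-2\omega}$-LD consistent if and only if, for every sequence $\varepsilon_i\to0$, $\varepsilon_i>0$, and every LD-inconsistent sequence of alternatives $S_{1\varepsilon_i}$ with $\|S_{1\varepsilon_i}\|\asymp\varepsilon_i^{2r}$, $$\|S_{\varepsilon_i}+S_{1\varepsilon_i}\|^2=\|S_{\varepsilon_i}\|^2+\|S_{1\varepsilon_i}\|^2+o(\varepsilon_i^{4r})\qquad (i\to\infty).$$ -/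

import Mathlib

open Filter Topology MeasureTheory ProbabilityTheory Asymptotics

noncomputable section

namespace SignalDetection

/-- The Hilbert space `L₂(0,1)` of real square-integrable signals. -/
abbrev Signal : Type := Lp ℝ 2 (volume.restrict (Set.Ioo (0 : ℝ) 1))

/-- The Fourier coefficient `θ_j = ∫ S φ_j` of a signal. -/
def coeff (φ : ℕ+ → Signal) (S : Signal) (j : ℕ+) : ℝ := inner ℝ (φ j) S

/-- The law of the observed coefficients `y_j = θ_j + ε ξ_j`, `j ≥ 1`, with `ξ_j` independent
standard normal: the `y_j` are independent, `y_j` being normal with mean `θ_j` and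
variance `ε²`. -/
def obsLaw (φ : ℕ+ → Signal) (ε : ℝ) (S : Signal) : Measure (ℕ+ → ℝ) :=
  Measure.infinitePi fun j => gaussianReal (coeff φ S j) (Real.toNNReal (ε ^ 2))

/-! The weights are `κ ε j ^ 2` with `j ≥ 1`; the value `κ ε 0` is never used. -/

/-- `ρ_ε² = ∑_{j ≥ 1} κ_{εj}²`. -/
def rhoSq (κ : ℝ → ℕ → ℝ) (ε : ℝ) : ℝ := ∑' j : ℕ+, κ ε j ^ 2

/-- `A_ε = ε⁻⁴ ∑_{j ≥ 1} κ_{εj}⁴`. -/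
def Anorm (κ : ℝ → ℕ → ℝ) (ε : ℝ) : ℝ := (ε ^ 4)⁻¹ * ∑' j : ℕ+, κ ε j ^ 4

/-- `k_ε = sup {k : ∑_{1 ≤ j < k} κ_{εj}² ≤ ρ_ε² / 2}`. -/
def kIndex (κ : ℝ → ℕ → ℝ) (ε : ℝ) : ℕ :=
  sSup {k : ℕ | ∑ j ∈ Finset.Ico 1 k, κ ε j ^ 2 ≤ 1 / 2 * rhoSq κ ε}

/-- `κ_ε² = κ_{ε k_ε}²`. -/
def kappaSq (κ : ℝ → ℕ → ℝ) (ε : ℝ) : ℝ := κ ε (kIndex κ ε) ^ 2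

/-- A1: for every `ε > 0` the sequence `κ_{εj}²`, `j ≥ 1`, is decreasing. -/
def CondA1 (κ : ℝ → ℕ → ℝ) : Prop :=
  ∀ ε : ℝ, 0 < ε → ∀ i j : ℕ, 1 ≤ i → i ≤ j → κ ε j ^ 2 ≤ κ ε i ^ 2

/-- A2: `A_ε` lies between two positive constants. -/
def CondA2 (κ : ℝ → ℕ → ℝ) : Prop :=
  ∃ C₁ C₂ : ℝ, 0 < C₁ ∧ ∀ ε : ℝ, 0 < ε → C₁ < Anorm κ ε ∧ Anorm κ ε < C₂

/-- A3: `κ²_{ε,[(1+δ)k_ε]} < C₁ (1+δ)^{-λ} κ_ε²` for all `δ > 0` and `ε > 0`. -/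
def CondA3 (κ : ℝ → ℕ → ℝ) : Prop :=
  ∃ C₁ lam : ℝ, 0 < C₁ ∧ 1 < lam ∧ ∀ δ : ℝ, 0 < δ → ∀ ε : ℝ, 0 < ε →
    κ ε ⌊(1 + δ) * (kIndex κ ε : ℝ)⌋₊ ^ 2 < C₁ * (1 + δ) ^ (-lam) * kappaSq κ ε

/-- A4: `κ_{ε1}² ≍ κ_ε²` as `ε → 0`, and for every `c > 1` there is `C > 0` with
`κ²_{ε,[c k_ε]} ≥ C κ_ε²` for all `ε > 0`. -/
def CondA4 (κ : ℝ → ℕ → ℝ) : Prop :=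
  ((fun ε : ℝ => κ ε 1 ^ 2) =Θ[𝓝[>] 0] fun ε : ℝ => kappaSq κ ε) ∧
  ∀ c : ℝ, 1 < c → ∃ C : ℝ, 0 < C ∧ ∀ ε : ℝ, 0 < ε →
    C * kappaSq κ ε ≤ κ ε ⌊c * (kIndex κ ε : ℝ)⌋₊ ^ 2

/-- The statistic `T_ε(y) = ε⁻² ∑ κ_{εj}² y_j² - ρ_ε²`. -/
def stat (κ : ℝ → ℕ → ℝ) (ε : ℝ) (y : ℕ+ → ℝ) : ℝ :=
  (ε ^ 2)⁻¹ * ∑' j : ℕ+, κ ε j ^ 2 * y j ^ 2 - rhoSq κ ε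

/-- The rejection region of the test `1{A_ε^{-1/2} T_ε > x}`. -/
def rejection (κ : ℝ → ℕ → ℝ) (ε x : ℝ) : Set (ℕ+ → ℝ) :=
  {y | x < (Real.sqrt (Anorm κ ε))⁻¹ * stat κ ε y}

/-- Type I error probability of the test with critical value `x`. -/
def typeI (φ : ℕ+ → Signal) (κ : ℝ → ℕ → ℝ) (ε x : ℝ) : ℝ :=
  (obsLaw φ ε 0).real (rejection κ ε x)

/-- Type II error probability, at the alternative `S`, of the test with critical value `x`. -/
def typeII (φ : ℕ+ → Signal) (κ : ℝ → ℕ → ℝ) (ε x : ℝ) (S : Signal) : ℝ :=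
  (obsLaw φ ε S).real (rejection κ ε x)ᶜ

/-- `ε^{-2ω}`-LD consistency of the alternatives `S i`, observed at noise level `e i`, along the
filter `l`. Write `R i = (e i)^{-2ω}`. For all critical values `x i` such that
`R⁻² log α → 0`, one has `|log β| = Ω(R²)`. The last relation is `c R² ≤ |log β|` with a
constant `c > 0`; as `0 ≤ β ≤ 1`, it is written `β ≤ exp (-c R²)`, which treats `β = 0`
(that is, `|log β| = ∞`) correctly.
For a family `S_ε`, `ε > 0`, the filter is `𝓝[>] 0` and `e = id`; for a sequence it is `atTop`. -/
def LDConsistent {ι : Type} (φ : ℕ+ → Signal) (κ : ℝ → ℕ → ℝ) (ω : ℝ)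
    (l : Filter ι) (e : ι → ℝ) (S : ι → Signal) : Prop :=
  ∀ x : ι → ℝ,
    Tendsto (fun i => ((e i ^ (-2 * ω)) ^ 2)⁻¹ * Real.log (typeI φ κ (e i) (x i))) l (𝓝 0) →
    ∃ c : ℝ, 0 < c ∧ ∀ᶠ i in l,
      typeII φ κ (e i) (x i) (S i) ≤ Real.exp (-(c * (e i ^ (-2 * ω)) ^ 2))

/-- An `ε^{-2ω}`-LD inconsistent sequence: consistency fails along every subsequence. -/
def LDInconsistent (φ : ℕ+ → Signal) (κ : ℝ → ℕ → ℝ) (ω : ℝ)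
    (e : ℕ → ℝ) (S : ℕ → Signal) : Prop :=
  ∀ n : ℕ → ℕ, StrictMono n → ¬ LDConsistent φ κ ω atTop (e ∘ n) (S ∘ n)

/-- Pure `ε^{-2ω}`-LD consistency of the family `S_ε`, `ε > 0`. -/
def PurelyLDConsistent (φ : ℕ+ → Signal) (κ : ℝ → ℕ → ℝ) (r ω : ℝ)
    (S : ℝ → Signal) : Prop :=
  LDConsistent φ κ ω (𝓝[>] 0) id S ∧
  ¬ ∃ (e : ℕ → ℝ) (S₁ : ℕ → Signal) (c₁ : ℝ),
      (∀ i, 0 < e i) ∧ Tendsto e atTop (𝓝 0) ∧ LDInconsistent φ κ ω e S₁ ∧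
      (∀ i, inner ℝ (S₁ i) (S (e i) - S₁ i) = 0) ∧
      0 < c₁ ∧ ∀ i, c₁ * e i ^ (2 * r) < ‖S₁ i‖

end SignalDetection

end

open SignalDetection

namespace SignalDetection

/-! ### Exponential moments of a squared normal variable -/

/-! Write R = ε^{-2ω}, n = (∑ κ_{εj}⁴)^{1/2} (`noiseScale`) and d = ε^{-2} ∑ κ_{εj}² θ_j²
(`signalShift`). The statistic has mean 0 and fluctuations of order n without signal, and mean d
under the signal. The assumptions make R κ_{ε1}² / n tend to 0 (`moderateWeights`), so every
exponential tilt v of order R / n satisfies v κ_{εj}² ≤ 1/8 eventually. In that range the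
exponential moments are Gaussian up to constants, and tails at distance of order R n have logarithm
of order -R².

Hence consistency is governed by the shift alone: d ≥ c R n suffices (`ldConsistent`), while d = o(R
n) rules it out (`not_ldConsistent`). A sequence is therefore inconsistent exactly when d = o(R n)
(`ldInconsistent_iff`). Since d is quadratic in the signal, bounded multiples of inconsistent
sequences remain inconsistent.

The rest is Hilbert space geometry. By expanding the square, the norm identity says that the inner
product of S with each inconsistent S₁ of norm of order ε^{2r} is o(ε^{4r}). If it is not, the
projection of S onto S₁ along a subsequence is a large inconsistent orthogonal part of S.
Conversely, such a part, or S itself if S is not consistent, has inner product with S equal to its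
own squared norm, which is not o(ε^{4r}). -/

theorem lintegral_exp_sq_gaussianReal (m : ℝ) {s : ℝ} (hs : 0 < s) {b : ℝ} (hb : 2 * b < 1) :
    ∫⁻ y, ENNReal.ofReal (Real.exp (b * (y ^ 2 / s ^ 2 - 1)))
        ∂gaussianReal m (Real.toNNReal (s ^ 2)) =
      ENNReal.ofReal (Real.exp (-b) * (√(1 - 2 * b))⁻¹ *
        Real.exp (b / (1 - 2 * b) * (m ^ 2 / s ^ 2))) := by
  have hs2 : 0 < s ^ 2 := by positivity
  have hq : 0 < 1 - 2 * b := by linarith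
  set q := 1 - 2 * b with hqdef
  have hv : Real.toNNReal (s ^ 2) ≠ 0 := by simpa using hs.ne'
  have hv' : Real.toNNReal (s ^ 2 / q) ≠ 0 := by
    rw [Ne, Real.toNNReal_eq_zero, not_le]; positivity
  rw [gaussianReal_of_var_ne_zero _ hv,
    lintegral_withDensity_eq_lintegral_mul _ (measurable_gaussianPDF _ _) (by fun_prop)]
  -- Completing the square: the tilted N(m, s²) density is a constant multiple of the density of
  -- N(m/q, s²/q).
  have key : ∀ y : ℝ, (gaussianPDF m (Real.toNNReal (s ^ 2)) *
      fun y => ENNReal.ofReal (Real.exp (b * (y ^ 2 / s ^ 2 - 1)))) y =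
      ENNReal.ofReal (Real.exp (-b) * (√q)⁻¹ * Real.exp (b / q * (m ^ 2 / s ^ 2))) *
        gaussianPDF (m / q) (Real.toNNReal (s ^ 2 / q)) y := by
    intro y
    simp only [Pi.mul_apply, gaussianPDF]
    rw [← ENNReal.ofReal_mul (gaussianPDFReal_nonneg _ _ _), ← ENNReal.ofReal_mul (by positivity)]
    congr 1
    simp only [gaussianPDFReal, Real.coe_toNNReal _ hs2.le,
      Real.coe_toNNReal _ (div_pos hs2 hq).le]
    have h1 : √(2 * Real.pi * (s ^ 2 / q)) = √(2 * Real.pi * s ^ 2) / √q := by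
      rw [← Real.sqrt_div (by positivity)]; congr 1; ring
    have h2 : Real.exp (-(y - m) ^ 2 / (2 * s ^ 2)) * Real.exp (b * (y ^ 2 / s ^ 2 - 1)) =
        Real.exp (-b) * Real.exp (b / q * (m ^ 2 / s ^ 2)) *
          Real.exp (-(y - m / q) ^ 2 / (2 * (s ^ 2 / q))) := by
      rw [← Real.exp_add, ← Real.exp_add, ← Real.exp_add]
      congr 1
      have hb' : b = (1 - q) / 2 := by rw [hqdef]; ring
      rw [hb']
      field_simp
      ring
    have hqs : √q ≠ 0 := (Real.sqrt_pos.2 hq).ne'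
    rw [h1, mul_assoc, h2]
    field_simp
  rw [lintegral_congr key, lintegral_const_mul _ (measurable_gaussianPDF _ _),
    lintegral_gaussianPDF_eq_one _ hv', mul_one]

theorem exp_neg_mul_inv_sqrt {b : ℝ} (hb : 2 * b < 1) :
    Real.exp (-b) * (√(1 - 2 * b))⁻¹ = Real.exp (-b - Real.log (1 - 2 * b) / 2) := by
  have hq : 0 < 1 - 2 * b := by linarith
  rw [sub_eq_add_neg (-b), Real.exp_add, Real.exp_neg (Real.log _ / 2), Real.sqrt_eq_rpow,
    Real.rpow_def_of_pos hq]
  congr 3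
  ring

theorem lintegral_exp_sq_gaussianReal_le (m : ℝ) {s : ℝ} (hs : 0 < s) {b : ℝ} (hb : |b| ≤ 1 / 8) :
    ∫⁻ y, ENNReal.ofReal (Real.exp (b * (y ^ 2 / s ^ 2 - 1)))
        ∂gaussianReal m (Real.toNNReal (s ^ 2)) ≤
      ENNReal.ofReal (Real.exp (3 * b ^ 2 + (b + 4 * b ^ 2) * (m ^ 2 / s ^ 2))) := by
  obtain ⟨hb1, hb2⟩ := abs_le.1 hb
  rw [lintegral_exp_sq_gaussianReal m hs (by linarith), exp_neg_mul_inv_sqrt (by linarith),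
    ← Real.exp_add]
  refine ENNReal.ofReal_le_ofReal (Real.exp_le_exp.2 ?_)
  have hu : |2 * b| ≤ 1 / 4 := by rw [abs_mul]; norm_num; linarith
  have hlog := Real.abs_log_sub_add_sum_range_le (x := 2 * b) (by linarith) 1
  simp only [Finset.range_one, Finset.sum_singleton] at hlog
  have h1 : |2 * b| ^ (1 + 1) / (1 - |2 * b|) ≤ 6 * b ^ 2 := by
    rw [div_le_iff₀ (by linarith), sq_abs]
    nlinarith [sq_nonneg b]
  have h2 := (abs_le.1 (hlog.trans h1)).1
  norm_num at h2
  have h3 : b / (1 - 2 * b) ≤ b + 4 * b ^ 2 := by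
    rw [div_le_iff₀ (by linarith)]
    nlinarith [sq_nonneg b]
  have h4 := mul_le_mul_of_nonneg_right h3 (show 0 ≤ m ^ 2 / s ^ 2 by positivity)
  linarith

theorem le_lintegral_exp_sq_gaussianReal {s : ℝ} (hs : 0 < s) {b : ℝ} (hb0 : 0 ≤ b)
    (hb : b ≤ 1 / 8) :
    ENNReal.ofReal (Real.exp (b ^ 2)) ≤
      ∫⁻ y, ENNReal.ofReal (Real.exp (b * (y ^ 2 / s ^ 2 - 1)))
        ∂gaussianReal 0 (Real.toNNReal (s ^ 2)) := by
  rw [lintegral_exp_sq_gaussianReal 0 hs (by linarith), exp_neg_mul_inv_sqrt (by linarith),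
    ← Real.exp_add]
  refine ENNReal.ofReal_le_ofReal (Real.exp_le_exp.2 ?_)
  -- Since b ≥ 0, all terms of the series of -log(1 - 2b) are nonnegative; the first two, 2b + 2b²,
  -- already suffice.
  have hlog := sum_le_hasSum (Finset.range 2) (fun i _ => by positivity)
    (Real.hasSum_pow_div_log_of_abs_lt_one (x := 2 * b) (by rw [abs_of_nonneg] <;> linarith))
  norm_num [Finset.sum_range_succ] at hlog ⊢
  linarith

/-! ### Exponential moments of weighted sums of squares -/

/-- The law of independent normal variables with means `m j` and common variance `s²`. -/
noncomputable def noisyLaw (m : ℕ+ → ℝ) (s : ℝ) : Measure (ℕ+ → ℝ) :=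
  Measure.infinitePi fun j => gaussianReal (m j) (Real.toNNReal (s ^ 2))

instance (m : ℕ+ → ℝ) (s : ℝ) : IsProbabilityMeasure (noisyLaw m s) := by
  unfold noisyLaw; infer_instance

/-- The centred quadratic statistic with weights `w`. -/
noncomputable def quadStat (w : ℕ+ → ℝ) (s : ℝ) (y : ℕ+ → ℝ) : ℝ :=
  (s ^ 2)⁻¹ * ∑' j, w j * y j ^ 2 - ∑' j, w j

variable {w m : ℕ+ → ℝ} {s : ℝ}

theorem measurable_quadStat (hw : ∀ j, 0 ≤ w j) : Measurable (quadStat w s) := by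
  have h : quadStat w s = fun y =>
      (s ^ 2)⁻¹ * (∑' j, ENNReal.ofReal (w j * y j ^ 2)).toReal - ∑' j, w j := by
    funext y
    -- Where the series diverges both sides take the default value 0, so the identity holds at every
    -- y.
    rw [quadStat, ENNReal.tsum_toReal_eq (fun _ => ENNReal.ofReal_ne_top)]
    simp_rw [ENNReal.toReal_ofReal (mul_nonneg (hw _) (sq_nonneg _))]
  rw [h]
  have : Measurable fun y : ℕ+ → ℝ => ∑' j, ENNReal.ofReal (w j * y j ^ 2) :=
    Measurable.tsum fun j => by fun_prop
  exact (this.ennreal_toReal.const_mul _).sub_const _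

theorem lintegral_finset_exp (F : Finset ℕ+) (b : ℕ+ → ℝ) :
    ∫⁻ y, ENNReal.ofReal (Real.exp (∑ j ∈ F, b j * (y j ^ 2 / s ^ 2 - 1))) ∂noisyLaw m s =
      ∏ j ∈ F, ∫⁻ y, ENNReal.ofReal (Real.exp (b j * (y ^ 2 / s ^ 2 - 1)))
        ∂gaussianReal (m j) (Real.toNNReal (s ^ 2)) := by
  have hX : ∀ j, Measurable fun t : ℝ => ENNReal.ofReal (Real.exp (b j * (t ^ 2 / s ^ 2 - 1))) :=
    fun j => by fun_prop
  unfold noisyLaw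
  simp_rw [Real.exp_sum, ENNReal.ofReal_prod_of_nonneg (fun _ _ => (Real.exp_pos _).le)]
  rw [lintegral_prod_eq_prod_lintegral_of_indepFun F
    (fun j (y : ℕ+ → ℝ) => ENNReal.ofReal (Real.exp (b j * (y j ^ 2 / s ^ 2 - 1))))
    (iIndepFun_infinitePi hX) (fun j => (hX j).comp (measurable_pi_apply j))]
  refine Finset.prod_congr rfl fun j _ => ?_
  exact (measurePreserving_eval_infinitePi
    (fun j => gaussianReal (m j) (Real.toNNReal (s ^ 2))) j).lintegral_comp (hX j)

/-- The sum has finite expectation ∑ w_j (m_j² + s²), so it is finite almost surely. -/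
theorem ae_summable_mul_sq (hw : ∀ j, 0 ≤ w j) (hws : Summable w)
    (hm : Summable fun j => w j * m j ^ 2) :
    ∀ᵐ y ∂noisyLaw m s, Summable fun j => w j * y j ^ 2 := by
  have hmeas : ∀ j, Measurable fun y : ℕ+ → ℝ => ENNReal.ofReal (w j * y j ^ 2) :=
    fun j => by fun_prop
  have h2 : ∀ j, ∫⁻ y, ENNReal.ofReal (w j * y j ^ 2) ∂noisyLaw m s =
      ENNReal.ofReal (w j * m j ^ 2 + w j * s ^ 2) := by
    intro j
    have hpres := measurePreserving_eval_infinitePi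
      (fun j => gaussianReal (m j) (Real.toNNReal (s ^ 2))) j
    have e1 : ∫⁻ y, ENNReal.ofReal (w j * y j ^ 2) ∂noisyLaw m s =
        ∫⁻ t, ENNReal.ofReal (w j * t ^ 2) ∂gaussianReal (m j) (Real.toNNReal (s ^ 2)) :=
      hpres.lintegral_comp (f := fun t : ℝ => ENNReal.ofReal (w j * t ^ 2)) (by fun_prop)
    have hL : MemLp (fun t : ℝ => t) 2 (gaussianReal (m j) (Real.toNNReal (s ^ 2))) :=
      memLp_id_gaussianReal 2
    have hvar := variance_eq_sub hL
    have hvar' : Var[fun t : ℝ => t; gaussianReal (m j) (Real.toNNReal (s ^ 2))] =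
        Real.toNNReal (s ^ 2) := variance_fun_id_gaussianReal
    rw [hvar', Real.coe_toNNReal _ (sq_nonneg s), integral_id_gaussianReal] at hvar
    rw [e1, ← ofReal_integral_eq_lintegral_ofReal (hL.integrable_sq.const_mul _)
      (ae_of_all _ fun t => mul_nonneg (hw j) (sq_nonneg t)), integral_const_mul]
    have : ∫ t : ℝ, t ^ 2 ∂gaussianReal (m j) (Real.toNNReal (s ^ 2)) = m j ^ 2 + s ^ 2 := by
      simp only [Pi.pow_apply] at hvar
      linarith
    rw [this]
    congr 1
    ring
  have h3 : ∫⁻ y, ∑' j, ENNReal.ofReal (w j * y j ^ 2) ∂noisyLaw m s ≠ ⊤ := by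
    rw [lintegral_tsum fun j => (hmeas j).aemeasurable]
    simp_rw [h2]
    exact (hm.add (hws.mul_right (s ^ 2))).tsum_ofReal_ne_top
  filter_upwards [ae_lt_top (Measurable.tsum hmeas) h3] with y hy
  have := ENNReal.summable_toReal hy.ne
  simpa only [ENNReal.toReal_ofReal (mul_nonneg (hw _) (sq_nonneg (y _)))] using this

theorem summable_sq_of_summable (hw : ∀ j, 0 ≤ w j) (hws : Summable w) :
    Summable fun j => w j ^ 2 := by
  have h1 : ∀ᶠ j in cofinite, w j ≤ 1 := by
    filter_upwards [hws.tendsto_cofinite_zero.eventually (ge_mem_nhds zero_lt_one)] with j hj using hj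
  refine Summable.of_norm_bounded_eventually hws ?_
  filter_upwards [h1] with j hj
  rw [Real.norm_of_nonneg (sq_nonneg _)]
  nlinarith [hw j]

theorem ae_hasSum_quadStat (hw : ∀ j, 0 ≤ w j) (hws : Summable w)
    (hm : Summable fun j => w j * m j ^ 2) (v : ℝ) :
    ∀ᵐ y ∂noisyLaw m s,
      HasSum (fun j => v * w j * (y j ^ 2 / s ^ 2 - 1)) (v * quadStat w s y) := by
  filter_upwards [ae_summable_mul_sq (s := s) hw hws hm] with y hy
  have := ((hy.hasSum.mul_left (s ^ 2)⁻¹).sub hws.hasSum).mul_left v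
  convert! this using 1
  funext j
  rw [div_eq_mul_inv]
  ring

/-- The mean of the centred statistic at the mean vector `m`. -/
noncomputable def meanShift (w m : ℕ+ → ℝ) (s : ℝ) : ℝ := (s ^ 2)⁻¹ * ∑' j, w j * m j ^ 2

/-- Independence gives the bound for finite partial sums, and Fatou's lemma carries it to the
series. The coefficient v + |v|/2 serves both tails: it is 3v/2 for v ≥ 0 and v/2 for v ≤ 0. -/
theorem lintegral_exp_quadStat_le (hs : 0 < s) (hw : ∀ j, 0 ≤ w j) (hws : Summable w)
    (hm : Summable fun j => w j * m j ^ 2) {v : ℝ} (hv : ∀ j, |v| * w j ≤ 1 / 8) :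
    ∫⁻ y, ENNReal.ofReal (Real.exp (v * quadStat w s y)) ∂noisyLaw m s ≤
      ENNReal.ofReal (Real.exp (3 * v ^ 2 * ∑' j, w j ^ 2 + (v + |v| / 2) * meanShift w m s)) := by
  have hsq := summable_sq_of_summable hw hws
  set f : Finset ℕ+ → (ℕ+ → ℝ) → ENNReal := fun F y =>
    ENNReal.ofReal (Real.exp (∑ j ∈ F, v * w j * (y j ^ 2 / s ^ 2 - 1)))
  have hlim : ∀ᵐ y ∂noisyLaw m s,
      ENNReal.ofReal (Real.exp (v * quadStat w s y)) = liminf (fun F => f F y) atTop := by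
    filter_upwards [ae_hasSum_quadStat (s := s) hw hws hm v] with y hy
    have : Tendsto (fun F => f F y) atTop
        (𝓝 (ENNReal.ofReal (Real.exp (v * quadStat w s y)))) :=
      ENNReal.tendsto_ofReal ((Real.continuous_exp.tendsto _).comp hy)
    exact this.liminf_eq.symm
  rw [lintegral_congr_ae hlim]
  refine (lintegral_liminf_le fun F => by fun_prop).trans ?_
  have hbound : ∀ F : Finset ℕ+, ∫⁻ y, f F y ∂noisyLaw m s ≤
      ENNReal.ofReal (Real.exp (∑ j ∈ F,
        (3 * v ^ 2 * w j ^ 2 + (v + |v| / 2) * ((s ^ 2)⁻¹ * (w j * m j ^ 2))))) := by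
    intro F
    rw [lintegral_finset_exp, Real.exp_sum,
      ENNReal.ofReal_prod_of_nonneg (fun _ _ => (Real.exp_pos _).le)]
    refine Finset.prod_le_prod' fun j _ => ?_
    have hvw : |v * w j| ≤ 1 / 8 := by rw [abs_mul, abs_of_nonneg (hw j)]; exact hv j
    refine (lintegral_exp_sq_gaussianReal_le (m j) hs hvw).trans
      (ENNReal.ofReal_le_ofReal (Real.exp_le_exp.2 ?_))
    -- The quadratic error in the mean term is absorbed into half of the linear one; this is what
    -- fixes the threshold 1/8.
    have h1 : 4 * (v * w j) ^ 2 ≤ |v| / 2 * w j := by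
      have := mul_le_mul_of_nonneg_left (hv j) (mul_nonneg (abs_nonneg v) (hw j))
      rw [mul_pow, ← sq_abs v]
      linarith
    have h2 := mul_le_mul_of_nonneg_right (add_le_add_right h1 (v * w j))
      (show 0 ≤ m j ^ 2 / s ^ 2 by positivity)
    refine (add_le_add_right h2 _).trans (le_of_eq ?_)
    rw [div_eq_mul_inv]
    ring
  refine (liminf_le_liminf (Eventually.of_forall hbound)).trans (le_of_eq ?_)
  have hsum : HasSum (fun j => 3 * v ^ 2 * w j ^ 2 + (v + |v| / 2) * ((s ^ 2)⁻¹ * (w j * m j ^ 2)))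
      (3 * v ^ 2 * ∑' j, w j ^ 2 + (v + |v| / 2) * meanShift w m s) :=
    (hsq.hasSum.mul_left _).add ((hm.hasSum.mul_left _).mul_left _)
  exact (ENNReal.tendsto_ofReal ((Real.continuous_exp.tendsto _).comp hsum)).liminf_eq

/-- Fatou's lemma points the wrong way here. Instead the squares outside a finite set are dropped,
which lowers the statistic to a finite sum minus the deterministic tail of the weights; that tail
vanishes in the limit. -/
theorem le_lintegral_exp_quadStat (hs : 0 < s) (hw : ∀ j, 0 ≤ w j) (hws : Summable w)
    {v : ℝ} (hv0 : 0 ≤ v) (hv : ∀ j, v * w j ≤ 1 / 8) :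
    ENNReal.ofReal (Real.exp (v ^ 2 * ∑' j, w j ^ 2)) ≤
      ∫⁻ y, ENNReal.ofReal (Real.exp (v * quadStat w s y)) ∂noisyLaw 0 s := by
  have hsq := summable_sq_of_summable hw hws
  have hbound : ∀ F : Finset ℕ+,
      ENNReal.ofReal (Real.exp (v ^ 2 * ∑ j ∈ F, w j ^ 2 - v * (∑' j, w j - ∑ j ∈ F, w j))) ≤
        ∫⁻ y, ENNReal.ofReal (Real.exp (v * quadStat w s y)) ∂noisyLaw 0 s := by
    intro F
    have h1 : ∀ᵐ y ∂noisyLaw 0 s, ENNReal.ofReal (Real.exp (-(v * (∑' j, w j - ∑ j ∈ F, w j)))) *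
        ENNReal.ofReal (Real.exp (∑ j ∈ F, v * w j * (y j ^ 2 / s ^ 2 - 1))) ≤
        ENNReal.ofReal (Real.exp (v * quadStat w s y)) := by
      filter_upwards [ae_summable_mul_sq (m := 0) (s := s) hw hws (by simp)]
        with y hy
      rw [← ENNReal.ofReal_mul (Real.exp_pos _).le, ← Real.exp_add]
      refine ENNReal.ofReal_le_ofReal (Real.exp_le_exp.2 ?_)
      have h2 := hy.sum_le_tsum F (fun j _ => mul_nonneg (hw j) (sq_nonneg (y j)))
      have h3 : ∑ j ∈ F, v * w j * (y j ^ 2 / s ^ 2 - 1) =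
          v * ((s ^ 2)⁻¹ * ∑ j ∈ F, w j * y j ^ 2) - v * ∑ j ∈ F, w j := by
        rw [Finset.mul_sum, Finset.mul_sum, Finset.mul_sum, ← Finset.sum_sub_distrib]
        refine Finset.sum_congr rfl fun j _ => ?_
        rw [div_eq_mul_inv]; ring
      have h4 := mul_le_mul_of_nonneg_left
        (mul_le_mul_of_nonneg_left h2 (show 0 ≤ (s ^ 2)⁻¹ by positivity)) hv0
      rw [h3, quadStat]
      linarith
    refine le_trans ?_ (lintegral_mono_ae h1)
    rw [lintegral_const_mul _ (by fun_prop), lintegral_finset_exp, sub_eq_add_neg, add_comm,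
      Real.exp_add, ENNReal.ofReal_mul (Real.exp_pos _).le, Finset.mul_sum, Real.exp_sum,
      ENNReal.ofReal_prod_of_nonneg (fun _ _ => (Real.exp_pos _).le)]
    refine mul_le_mul_right (Finset.prod_le_prod' fun j _ => ?_) _
    rw [← mul_pow]
    exact le_lintegral_exp_sq_gaussianReal hs (mul_nonneg hv0 (hw j)) (hv j)
  have hlim : Tendsto (fun F : Finset ℕ+ =>
      v ^ 2 * ∑ j ∈ F, w j ^ 2 - v * (∑' j, w j - ∑ j ∈ F, w j)) atTop
      (𝓝 (v ^ 2 * ∑' j, w j ^ 2 - v * (∑' j, w j - ∑' j, w j))) :=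
    (hsq.hasSum.const_mul _).sub ((tendsto_const_nhds.sub hws.hasSum).const_mul _)
  rw [sub_self, mul_zero, sub_zero] at hlim
  exact le_of_tendsto' (ENNReal.tendsto_ofReal ((Real.continuous_exp.tendsto _).comp hlim)) hbound

/-! ### Tail bounds -/

theorem measure_real_le_of_exp_bound {Ω : Type*} [MeasurableSpace Ω] {μ : Measure Ω} {f : Ω → ℝ}
    (hf : Measurable f) {A : Set Ω} {t B : ℝ} (hA : ∀ y ∈ A, t ≤ f y)
    (hB : ∫⁻ y, ENNReal.ofReal (Real.exp (f y)) ∂μ ≤ ENNReal.ofReal (Real.exp B)) :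
    μ.real A ≤ Real.exp (B - t) := by
  have hpos : ENNReal.ofReal (Real.exp t) ≠ 0 := by simpa using Real.exp_pos t
  refine ENNReal.toReal_le_of_le_ofReal (Real.exp_pos _).le ?_
  have hsub : A ⊆ {y | ENNReal.ofReal (Real.exp t) ≤ ENNReal.ofReal (Real.exp (f y))} :=
    fun y hy => ENNReal.ofReal_le_ofReal (Real.exp_le_exp.2 (hA y hy))
  refine (measure_mono hsub).trans ((meas_ge_le_lintegral_div (by fun_prop) hpos
    ENNReal.ofReal_ne_top).trans ?_)
  rw [Real.exp_sub, ENNReal.ofReal_div_of_pos (Real.exp_pos _)]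
  gcongr

/-- Chernoff bound for the upper tail. -/
theorem upper_tail_le (hs : 0 < s) (hw : ∀ j, 0 ≤ w j) (hws : Summable w)
    (hm : Summable fun j => w j * m j ^ 2) {v : ℝ} (hv0 : 0 ≤ v) (hv : ∀ j, v * w j ≤ 1 / 8)
    (x : ℝ) :
    (noisyLaw m s).real {y | x < quadStat w s y} ≤
      Real.exp (3 * v ^ 2 * ∑' j, w j ^ 2 + 3 / 2 * v * meanShift w m s - v * x) := by
  have h := lintegral_exp_quadStat_le hs hw hws hm (v := v) (by rwa [abs_of_nonneg hv0])
  rw [abs_of_nonneg hv0] at h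
  refine (measure_real_le_of_exp_bound ((measurable_quadStat hw).const_mul v)
    (t := v * x) (fun y hy => mul_le_mul_of_nonneg_left (le_of_lt hy) hv0) h).trans (le_of_eq ?_)
  congr 1; ring

/-- Chernoff bound for the lower tail. -/
theorem lower_tail_le (hs : 0 < s) (hw : ∀ j, 0 ≤ w j) (hws : Summable w)
    (hm : Summable fun j => w j * m j ^ 2) {v : ℝ} (hv0 : 0 ≤ v) (hv : ∀ j, v * w j ≤ 1 / 8)
    (x : ℝ) :
    (noisyLaw m s).real {y | x < quadStat w s y}ᶜ ≤
      Real.exp (3 * v ^ 2 * ∑' j, w j ^ 2 - v / 2 * meanShift w m s + v * x) := by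
  have h := lintegral_exp_quadStat_le hs hw hws hm (v := -v) (by rwa [abs_neg, abs_of_nonneg hv0])
  rw [abs_neg, abs_of_nonneg hv0] at h
  refine (measure_real_le_of_exp_bound ((measurable_quadStat hw).const_mul (-v))
    (t := -v * x) (fun y hy => ?_) h).trans (le_of_eq ?_)
  · have : quadStat w s y ≤ x := not_lt.1 hy
    nlinarith
  congr 1; ring

/-- Second moment lower bound for the upper tail. -/
theorem le_upper_tail (hs : 0 < s) (hw : ∀ j, 0 ≤ w j) (hws : Summable w)
    {v : ℝ} (hv0 : 0 ≤ v) (hv : ∀ j, 2 * v * w j ≤ 1 / 8) {x : ℝ}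
    (hx : v * x + 1 ≤ v ^ 2 * ∑' j, w j ^ 2) :
    Real.exp (-(12 * v ^ 2 * ∑' j, w j ^ 2)) / 16 ≤
      (noisyLaw 0 s).real {y | x < quadStat w s y} := by
  set q := v ^ 2 * ∑' j, w j ^ 2 with hq
  set P := noisyLaw (0 : ℕ+ → ℝ) s
  set A : Set (ℕ+ → ℝ) := {y | x < quadStat w s y}
  have hmeas := measurable_quadStat (s := s) hw
  have hA : MeasurableSet A := measurableSet_lt measurable_const hmeas
  have hq0 : 0 ≤ q := mul_nonneg (sq_nonneg _) (tsum_nonneg fun _ => sq_nonneg _)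
  have h0 : Summable fun j => w j * (0 : ℕ+ → ℝ) j ^ 2 := by simp
  have hlow := le_lintegral_exp_quadStat hs hw hws hv0 (fun j => by
    linarith [hv j, mul_nonneg hv0 (hw j)])
  have hup := lintegral_exp_quadStat_le (m := 0) hs hw hws h0 (v := 2 * v)
    (by rwa [abs_of_nonneg (by positivity)])
  have hshift : meanShift w 0 s = 0 := by simp [meanShift]
  rw [hshift, mul_zero, add_zero, show 3 * (2 * v) ^ 2 * ∑' j, w j ^ 2 = 12 * q by
    rw [hq]; ring] at hup
  -- With z = exp(vT), split z ≤ e^{q-1} off A and z ≤ z²/M + M on A. This M makes the second moment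
  -- term at most 1/4, leaving e^q ≤ e^q/2 + 1/4 + M P(A), hence M P(A) ≥ 1/4.
  set M := 4 * Real.exp (12 * q) with hM
  have hM0 : 0 < M := by positivity
  have hpt : ∀ y, ENNReal.ofReal (Real.exp (v * quadStat w s y)) ≤
      ENNReal.ofReal (Real.exp (q - 1)) +
        (ENNReal.ofReal M⁻¹ * ENNReal.ofReal (Real.exp (2 * v * quadStat w s y)) +
          A.indicator (fun _ => ENNReal.ofReal M) y) := by
    intro y
    by_cases hy : y ∈ A
    · rw [Set.indicator_of_mem hy, ← ENNReal.ofReal_mul (by positivity),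
        ← ENNReal.ofReal_add (by positivity) hM0.le]
      refine le_trans (ENNReal.ofReal_le_ofReal ?_) le_add_self
      set z := Real.exp (v * quadStat w s y) with hz
      have : Real.exp (2 * v * quadStat w s y) = z ^ 2 := by
        rw [hz, ← Real.exp_nat_mul]; congr 1; push_cast; ring
      rw [this, inv_mul_eq_div, ← sub_le_iff_le_add, le_div_iff₀ hM0]
      nlinarith [sq_nonneg (z - M), sq_nonneg z]
    · refine le_trans (ENNReal.ofReal_le_ofReal (Real.exp_le_exp.2 ?_)) le_self_add
      have : quadStat w s y ≤ x := not_lt.1 hy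
      nlinarith
  have hint := hlow.trans (lintegral_mono hpt)
  rw [lintegral_add_left measurable_const, lintegral_const, measure_univ, mul_one,
    lintegral_add_left (by fun_prop), lintegral_const_mul _ (by fun_prop),
    lintegral_indicator_const hA] at hint
  have hint2 := hint.trans (add_le_add_right (add_le_add_left (mul_le_mul_right hup _) _) _)
  rw [← ofReal_measureReal, ← ENNReal.ofReal_mul (by positivity),
    ← ENNReal.ofReal_mul hM0.le, ← ENNReal.ofReal_add (by positivity) (by positivity),
    ← ENNReal.ofReal_add (by positivity) (by positivity),
    ENNReal.ofReal_le_ofReal_iff (by positivity)] at hint2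
  have e1 : M⁻¹ * Real.exp (12 * q) = 1 / 4 := by
    rw [hM]; field_simp
  rw [e1] at hint2
  have e2 : Real.exp (q - 1) ≤ Real.exp q / 2 := by
    rw [Real.exp_sub]
    refine div_le_div_of_nonneg_left (Real.exp_pos _).le two_pos ?_
    linarith [Real.add_one_le_exp (1 : ℝ)]
  have e3 : 1 ≤ Real.exp q := Real.one_le_exp hq0
  have e4 : 1 / 4 ≤ M * P.real A := by linarith
  rw [show 12 * v ^ 2 * ∑' j, w j ^ 2 = 12 * q by rw [hq]; ring, Real.exp_neg]
  rw [hM] at e4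
  rw [← div_le_iff₀' (by positivity)] at e4
  refine le_trans (le_of_eq ?_) e4
  field_simp
  norm_num

/-- One large coordinate already forces rejection, and a Gaussian charges every nonempty open set.
This keeps log α away from the default value log 0 = 0. -/
theorem upper_tail_pos (hs : 0 < s) (hw : ∀ j, 0 ≤ w j) (hws : Summable w) (hw1 : 0 < w 1)
    (x : ℝ) : 0 < (noisyLaw 0 s).real {y | x < quadStat w s y} := by
  have hv : Real.toNNReal (s ^ 2) ≠ 0 := by simpa using hs.ne'
  have h0 : Summable fun j => w j * (0 : ℕ+ → ℝ) j ^ 2 := by simp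
  set U : Set ℝ := {t | x + ∑' j, w j < (s ^ 2)⁻¹ * (w 1 * t ^ 2)} with hU
  have hUo : IsOpen U := isOpen_lt continuous_const (by fun_prop)
  have hUne : U.Nonempty := by
    have hc : 0 < (s ^ 2)⁻¹ * w 1 := by positivity
    have ht : Tendsto (fun t : ℝ => (s ^ 2)⁻¹ * w 1 * t ^ 2) atTop atTop :=
      (tendsto_pow_atTop two_ne_zero).const_mul_atTop hc
    obtain ⟨t, ht⟩ := (ht.eventually_gt_atTop (x + ∑' j, w j)).exists
    exact ⟨t, by rw [hU, Set.mem_ofPred_eq, ← mul_assoc]; exact ht⟩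
  have hpos : gaussianReal 0 (Real.toNNReal (s ^ 2)) U ≠ 0 := fun h =>
    (hUo.measure_pos volume hUne).ne' (gaussianReal_absolutelyContinuous' 0 hv h)
  have hpres : noisyLaw 0 s ((fun y => y 1) ⁻¹' U) =
      gaussianReal 0 (Real.toNNReal (s ^ 2)) U :=
    (measurePreserving_eval_infinitePi
      (fun j : ℕ+ => gaussianReal ((0 : ℕ+ → ℝ) j) (Real.toNNReal (s ^ 2))) 1).measure_preimage
      hUo.measurableSet.nullMeasurableSet
  rw [measureReal_def, ENNReal.toReal_pos_iff]
  refine ⟨pos_iff_ne_zero.2 fun h => hpos ?_, measure_lt_top _ _⟩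
  rw [← hpres]
  refine measure_mono_null_ae ?_ h
  filter_upwards [ae_summable_mul_sq (s := s) hw hws h0] with y hy hyU
  have h2 := hy.le_tsum 1 (fun j _ => mul_nonneg (hw j) (sq_nonneg (y j)))
  have h3 := mul_le_mul_of_nonneg_left h2 (show 0 ≤ (s ^ 2)⁻¹ by positivity)
  have h4 : x + ∑' j, w j < (s ^ 2)⁻¹ * (w 1 * y 1 ^ 2) := hyU
  change x < quadStat w s y
  rw [quadStat]
  linarith

/-! ### The tests in terms of the centred statistic -/

/-- The standard deviation scale `(∑ κ_{εj}⁴)^{1/2}` of the statistic. -/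
noncomputable def noiseScale (κ : ℝ → ℕ → ℝ) (ε : ℝ) : ℝ := √(∑' j : ℕ+, κ ε j ^ 4)

/-- The mean of the statistic at the signal `S`. -/
noncomputable def signalShift (φ : ℕ+ → Signal) (κ : ℝ → ℕ → ℝ) (ε : ℝ) (S : Signal) : ℝ :=
  meanShift (fun j => κ ε j ^ 2) (coeff φ S) ε

/-- Weights for which the large deviation scale `ε^{-2ω}` lies in the Gaussian range. -/
structure ModerateWeights (κ : ℝ → ℕ → ℝ) (ω : ℝ) : Prop where
  summable : ∀ ε : ℝ, 0 < ε → Summable fun j : ℕ+ => κ ε j ^ 2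
  le_first : ∀ ε : ℝ, 0 < ε → ∀ j : ℕ+, κ ε j ^ 2 ≤ κ ε 1 ^ 2
  pos : ∀ ε : ℝ, 0 < ε → 0 < ∑' j : ℕ+, κ ε j ^ 4
  tendsto : Tendsto (fun ε : ℝ => ε ^ (-2 * ω) * (κ ε 1 ^ 2 / noiseScale κ ε)) (𝓝[>] 0) (𝓝 0)

variable {φ : ℕ+ → Signal} {κ : ℝ → ℕ → ℝ} {r ω : ℝ} {ε : ℝ} {S : Signal}

theorem coeff_zero : coeff φ 0 = 0 := by
  funext j
  simp [coeff]

theorem coeff_smul (a : ℝ) (S : Signal) (j : ℕ+) : coeff φ (a • S) j = a * coeff φ S j :=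
  real_inner_smul_right _ _ _

theorem signalShift_smul (a : ℝ) (S : Signal) :
    signalShift φ κ ε (a • S) = a ^ 2 * signalShift φ κ ε S := by
  simp only [signalShift, meanShift, coeff_smul]
  have : ∀ j : ℕ+, κ ε j ^ 2 * (a * coeff φ S j) ^ 2 =
      a ^ 2 * (κ ε j ^ 2 * coeff φ S j ^ 2) := fun j => by ring
  simp_rw [this, tsum_mul_left]
  ring

theorem signalShift_nonneg : 0 ≤ signalShift φ κ ε S :=
  mul_nonneg (inv_nonneg.2 (sq_nonneg _))
    (tsum_nonneg fun _ => mul_nonneg (sq_nonneg _) (sq_nonneg _))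

theorem coeff_sq_le (hφ : Orthonormal ℝ φ) (S : Signal) (j : ℕ+) : coeff φ S j ^ 2 ≤ ‖S‖ ^ 2 := by
  have h : |coeff φ S j| ≤ ‖S‖ := by
    simpa [coeff, hφ.1 j] using abs_real_inner_le_norm (φ j) S
  exact sq_le_sq.2 (by rwa [abs_norm])

theorem summable_weighted_coeff (hφ : Orthonormal ℝ φ)
    (hκ : Summable fun j : ℕ+ => κ ε j ^ 2) (S : Signal) :
    Summable fun j : ℕ+ => κ ε j ^ 2 * coeff φ S j ^ 2 :=
  Summable.of_nonneg_of_le (fun _ => mul_nonneg (sq_nonneg _) (sq_nonneg _))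
    (fun j => mul_le_mul_of_nonneg_left (coeff_sq_le hφ S j) (sq_nonneg _))
    (hκ.mul_right (‖S‖ ^ 2))

theorem rejection_eq (hA : 0 < Anorm κ ε) (x : ℝ) :
    rejection κ ε x = {y | √(Anorm κ ε) * x < quadStat (fun j => κ ε j ^ 2) ε y} := by
  ext y
  have h := Real.sqrt_pos.2 hA
  change x < (√(Anorm κ ε))⁻¹ * stat κ ε y ↔ √(Anorm κ ε) * x < stat κ ε y
  rw [inv_mul_eq_div, lt_div_iff₀' h]

theorem typeI_eq (hA : 0 < Anorm κ ε) (x : ℝ) :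
    typeI φ κ ε x = (noisyLaw 0 ε).real
      {y | √(Anorm κ ε) * x < quadStat (fun j => κ ε j ^ 2) ε y} := by
  rw [typeI, rejection_eq hA, ← coeff_zero (φ := φ)]
  rfl

theorem typeII_eq (hA : 0 < Anorm κ ε) (x : ℝ) (S : Signal) :
    typeII φ κ ε x S = (noisyLaw (coeff φ S) ε).real
      {y | √(Anorm κ ε) * x < quadStat (fun j => κ ε j ^ 2) ε y}ᶜ := by
  rw [typeII, rejection_eq hA]
  rfl

theorem tsum_sq_sq : ∑' j : ℕ+, (κ ε j ^ 2) ^ 2 = ∑' j : ℕ+, κ ε j ^ 4 :=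
  tsum_congr fun j => by ring

namespace ModerateWeights

variable (h : ModerateWeights κ ω)
include h

theorem Anorm_pos (hε : 0 < ε) : 0 < Anorm κ ε := mul_pos (by positivity) (h.pos ε hε)

theorem noiseScale_pos (hε : 0 < ε) : 0 < noiseScale κ ε := Real.sqrt_pos.2 (h.pos ε hε)

theorem tsum_eq (hε : 0 < ε) : ∑' j : ℕ+, (κ ε j ^ 2) ^ 2 = noiseScale κ ε ^ 2 := by
  rw [tsum_sq_sq, noiseScale, Real.sq_sqrt (h.pos ε hε).le]

theorem first_pos (hε : 0 < ε) : 0 < κ ε 1 ^ 2 := by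
  by_contra hle
  have h0 : ∀ j : ℕ+, κ ε j ^ 2 = 0 := fun j =>
    le_antisymm ((h.le_first ε hε j).trans (not_lt.1 hle)) (sq_nonneg _)
  have h1 := h.pos ε hε
  rw [← tsum_sq_sq] at h1
  simp [h0] at h1

theorem typeI_pos (hε : 0 < ε) (x : ℝ) : 0 < typeI φ κ ε x := by
  rw [typeI_eq (h.Anorm_pos hε)]
  exact upper_tail_pos hε (fun _ => sq_nonneg _) (h.summable ε hε) (h.first_pos hε) _

/-- Eventual validity of the exponential bounds at the scale `ε^{-2ω}`. -/
theorem eventually_small {ι : Type} {l : Filter ι} {e : ι → ℝ} (he : Tendsto e l (𝓝[>] 0))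
    {a : ℝ} (ha : 0 < a) :
    ∀ᶠ i in l, ∀ v : ℝ, v ≤ a * e i ^ (-2 * ω) / noiseScale κ (e i) →
      ∀ j : ℕ+, v * κ (e i) j ^ 2 ≤ 1 / 8 := by
  have hpos : ∀ᶠ i in l, 0 < e i := he.eventually self_mem_nhdsWithin
  have hsm := (h.tendsto.comp he).eventually_lt_const (show (0 : ℝ) < 1 / (8 * a) by positivity)
  filter_upwards [hpos, hsm] with i hi hs v hv j
  have hR : 0 < e i ^ (-2 * ω) := Real.rpow_pos_of_pos hi _
  have hn := h.noiseScale_pos hi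
  have h1 : v * κ (e i) j ^ 2 ≤ a * e i ^ (-2 * ω) / noiseScale κ (e i) * κ (e i) 1 ^ 2 :=
    (mul_le_mul_of_nonneg_right hv (sq_nonneg _)).trans
      (mul_le_mul_of_nonneg_left (h.le_first _ hi j) (by positivity))
  refine h1.trans ?_
  have h2 := mul_lt_mul_of_pos_left hs ha
  simp only [Function.comp_apply] at h2
  have e1 : a * (1 / (8 * a)) = 1 / 8 := by field_simp
  rw [e1] at h2
  refine le_trans (le_of_eq ?_) h2.le
  ring

/-! ### The criterion for large deviation consistency -/

/-- A subexponential type I error forces the threshold below a small fraction of the shift; the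
Chernoff bound for the lower tail then makes the type II error exponentially small. -/
theorem ldConsistent (hφ : Orthonormal ℝ φ) {ι : Type} {l : Filter ι} {e : ι → ℝ}
    (he : Tendsto e l (𝓝[>] 0)) {S : ι → Signal} {c : ℝ} (hc : 0 < c)
    (hS : ∀ᶠ i in l, c * (e i ^ (-2 * ω) * noiseScale κ (e i)) ≤ signalShift φ κ (e i) (S i)) :
    LDConsistent φ κ ω l e S := by
  intro x hx
  refine ⟨c ^ 2 / 96, by positivity, ?_⟩
  have hpos : ∀ᶠ i in l, 0 < e i := he.eventually self_mem_nhdsWithin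
  have hη : 0 < c / 32 := by positivity
  have hlog := hx.eventually_const_lt (show -(c / 32) ^ 2 < 0 from neg_lt_zero.2 (by positivity))
  filter_upwards [hpos, hS, hlog, h.eventually_small he hη,
    h.eventually_small he (show 0 < c / 24 by positivity)] with i hi hSi hli h1 h2
  set R := e i ^ (-2 * ω)
  have hR : 0 < R := Real.rpow_pos_of_pos hi _
  set n := noiseScale κ (e i) with hn_def
  have hn : 0 < n := h.noiseScale_pos hi
  have hA := h.Anorm_pos hi
  have hw : ∀ j : ℕ+, 0 ≤ κ (e i) j ^ 2 := fun _ => sq_nonneg _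
  have hws := h.summable _ hi
  set t := √(Anorm κ (e i)) * x i with ht_def
  have ht : t ≤ c / 8 * (R * n) := by
    by_contra! hlt
    -- If t exceeded (c/8) R n, this tilt would give the exponent (3 - 4)(c/32)² R², contradicting
    -- `hli`.
    have hα := upper_tail_le (m := 0) hi hw hws (by simp) (v := c / 32 * R / n)
      (by positivity) (h1 _ le_rfl) t
    rw [h.tsum_eq hi, ← typeI_eq (φ := φ) hA] at hα
    have hα' := (Real.log_le_iff_le_exp (h.typeI_pos hi _)).2 hα
    have hz : meanShift (fun j : ℕ+ => κ (e i) j ^ 2) 0 (e i) = 0 := by simp [meanShift]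
    rw [hz, mul_zero, add_zero] at hα'
    have e1 : 3 * (c / 32 * R / n) ^ 2 * n ^ 2 = 3 * (c / 32) ^ 2 * R ^ 2 := by
      field_simp
    have e2 : 4 * (c / 32) ^ 2 * R ^ 2 ≤ c / 32 * R / n * t := by
      refine le_trans (le_of_eq ?_)
        (mul_le_mul_of_nonneg_left hlt.le (show 0 ≤ c / 32 * R / n by positivity))
      field_simp
      norm_num
    rw [← hn_def, e1] at hα'
    rw [inv_mul_eq_div, lt_div_iff₀ (by positivity)] at hli
    linarith
  -- The exponent is c² R² (1/192 - 1/48 + 1/192) = -c² R² / 96.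
  have hβ := lower_tail_le hi hw hws (summable_weighted_coeff hφ hws (S i))
    (v := c / 24 * R / n) (by positivity) (h2 _ le_rfl) t
  rw [h.tsum_eq hi, ← typeII_eq hA, ← hn_def] at hβ
  refine hβ.trans (Real.exp_le_exp.2 ?_)
  change _ - _ * signalShift φ κ (e i) (S i) + _ ≤ _
  have hv : 0 ≤ c / 24 * R / n := by positivity
  have e1 : 3 * (c / 24 * R / n) ^ 2 * n ^ 2 = 3 * (c / 24) ^ 2 * R ^ 2 := by
    field_simp
  have e2 := mul_le_mul_of_nonneg_left ht hv
  have e3 := mul_le_mul_of_nonneg_left hSi (show 0 ≤ c / 24 * R / n / 2 by positivity)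
  have e4 : c / 24 * R / n * (c / 8 * (R * n)) = c ^ 2 / 192 * R ^ 2 := by field_simp; norm_num
  have e5 : c / 24 * R / n / 2 * (c * (R * n)) = c ^ 2 / 48 * R ^ 2 := by field_simp; norm_num
  rw [e4] at e2
  rw [e5] at e3
  rw [e1]
  linarith

/-- A single test refutes consistency: its threshold lies far enough above the shift that the type
II error stays above 1/2, yet is o(R n), so that log α = o(R²). -/
theorem not_ldConsistent (hω : 0 < ω) (hφ : Orthonormal ℝ φ) {ι : Type} {l : Filter ι} [l.NeBot]
    {e : ι → ℝ} (he : Tendsto e l (𝓝[>] 0)) {S : ι → Signal}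
    (hS : ∀ c : ℝ, 0 < c → ∀ᶠ i in l,
      signalShift φ κ (e i) (S i) ≤ c * (e i ^ (-2 * ω) * noiseScale κ (e i))) :
    ¬ LDConsistent φ κ ω l e S := by
  have hpos : ∀ᶠ i in l, 0 < e i := he.eventually self_mem_nhdsWithin
  have hR : Tendsto (fun i => e i ^ (-2 * ω)) l atTop :=
    (tendsto_rpow_neg_nhdsGT_zero (by linarith)).comp he
  set d : ι → ℝ := fun i => signalShift φ κ (e i) (S i) / noiseScale κ (e i) with hd
  have hd0 : ∀ᶠ i in l, 0 ≤ d i := by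
    filter_upwards [hpos] with i hi
    exact div_nonneg signalShift_nonneg (h.noiseScale_pos hi).le
  have hdR : Tendsto (fun i => (2 * d i + 5) / e i ^ (-2 * ω)) l (𝓝 0) := by
    have h1 : Tendsto (fun i => d i / e i ^ (-2 * ω)) l (𝓝 0) := by
      rw [Metric.tendsto_nhds]
      intro c hc
      filter_upwards [hpos, hd0, hS (c / 2) (by positivity)] with i hi hdi hSi
      have hRi : 0 < e i ^ (-2 * ω) := Real.rpow_pos_of_pos hi _
      rw [Real.dist_eq, sub_zero, abs_of_nonneg (div_nonneg hdi hRi.le), div_lt_iff₀ hRi]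
      have : d i ≤ c / 2 * e i ^ (-2 * ω) := by
        rw [hd]
        refine (div_le_iff₀ (h.noiseScale_pos hi)).2 ?_
        linarith
      nlinarith
    have h2 := (h1.const_mul 2).add (hR.inv_tendsto_atTop.const_mul 5)
    simp only [mul_zero, add_zero] at h2
    refine h2.congr fun i => ?_
    simp only [Pi.inv_apply]
    ring
  intro hcons
  -- The multiple 2d + 4 of the noise scale (d now being the normalised shift) beats 3 + 3d/2 in the
  -- Chernoff exponent at v = 1/n by at least 1. The tilt (2d + 5)/n will give the lower bound for
  -- α.
  set x : ι → ℝ := fun i => (√(Anorm κ (e i)))⁻¹ * ((2 * d i + 4) * noiseScale κ (e i)) with hx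
  have hthr : ∀ i, 0 < e i → √(Anorm κ (e i)) * x i = (2 * d i + 4) * noiseScale κ (e i) := by
    intro i hi
    rw [hx, mul_inv_cancel_left₀ (Real.sqrt_pos.2 (h.Anorm_pos hi)).ne']
  have hα : Tendsto (fun i => ((e i ^ (-2 * ω)) ^ 2)⁻¹ * Real.log (typeI φ κ (e i) (x i))) l
      (𝓝 0) := by
    have hlow : ∀ᶠ i in l, -(12 * ((2 * d i + 5) / e i ^ (-2 * ω)) ^ 2 +
        Real.log 16 * ((e i ^ (-2 * ω)) ^ 2)⁻¹) ≤
        ((e i ^ (-2 * ω)) ^ 2)⁻¹ * Real.log (typeI φ κ (e i) (x i)) := by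
      filter_upwards [hpos, hd0, hdR.eventually_lt_const (show (0 : ℝ) < 1 by norm_num),
        h.eventually_small he (show (0 : ℝ) < 2 by norm_num)] with i hi hdi hlt hsmall
      have hRi : 0 < e i ^ (-2 * ω) := Real.rpow_pos_of_pos hi _
      have hn := h.noiseScale_pos hi
      rw [div_lt_one hRi] at hlt
      have hv : (2 * d i + 5) / noiseScale κ (e i) * noiseScale κ (e i) = 2 * d i + 5 :=
        div_mul_cancel₀ _ hn.ne'
      have hup := le_upper_tail hi (fun _ => sq_nonneg _) (h.summable _ hi)
        (v := (2 * d i + 5) / noiseScale κ (e i)) (by positivity)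
        (hsmall _ (by rw [← mul_div_assoc]; gcongr))
        (x := (2 * d i + 4) * noiseScale κ (e i)) (by
          rw [h.tsum_eq hi, ← mul_pow, hv]
          nlinarith)
      rw [h.tsum_eq hi, mul_assoc, ← mul_pow, hv, ← hthr i hi,
        ← typeI_eq (φ := φ) (h.Anorm_pos hi)] at hup
      have hl := Real.log_le_log (by positivity) hup
      rw [Real.log_div (Real.exp_pos _).ne' (by norm_num), Real.log_exp] at hl
      refine le_trans (le_of_eq ?_)
        (mul_le_mul_of_nonneg_left hl (show 0 ≤ ((e i ^ (-2 * ω)) ^ 2)⁻¹ by positivity))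
      rw [div_pow, div_eq_mul_inv]
      ring
    have hR2 : Tendsto (fun i => ((e i ^ (-2 * ω)) ^ 2)⁻¹) l (𝓝 0) :=
      ((tendsto_pow_atTop two_ne_zero).comp hR).inv_tendsto_atTop
    have hlim := (((hdR.pow 2).const_mul 12).add (hR2.const_mul (Real.log 16))).neg
    norm_num at hlim
    refine tendsto_of_tendsto_of_tendsto_of_le_of_le' (by norm_num; exact hlim) tendsto_const_nhds
      hlow ?_
    filter_upwards [hpos] with i hi
    refine mul_nonpos_of_nonneg_of_nonpos (by positivity) (Real.log_nonpos ?_ ?_)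
    · exact (h.typeI_pos hi _).le
    · rw [typeI_eq (h.Anorm_pos hi)]
      exact measureReal_le_one
  obtain ⟨c, hc, hβ⟩ := hcons x hα
  have hlim : Tendsto (fun i => Real.exp (-(c * (e i ^ (-2 * ω)) ^ 2))) l (𝓝 0) :=
    Real.tendsto_exp_neg_atTop_nhds_zero.comp
      (((tendsto_pow_atTop two_ne_zero).comp hR).const_mul_atTop hc)
  have hR1 := hR.eventually_ge_atTop 1
  obtain ⟨i, hi, hdi, hβi, hlt, hR1, hsmall⟩ := (hpos.and (hd0.and (hβ.and
    ((hlim.eventually_lt_const (show (0 : ℝ) < 1 / 2 by norm_num)).and (hR1.and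
      (h.eventually_small he one_pos)))))).exists
  have hn := h.noiseScale_pos hi
  have hw : ∀ j : ℕ+, 0 ≤ κ (e i) j ^ 2 := fun _ => sq_nonneg _
  have hws := h.summable _ hi
  have hup := upper_tail_le hi hw hws (summable_weighted_coeff hφ hws (S i))
    (v := 1 / noiseScale κ (e i)) (by positivity)
    (hsmall _ (by gcongr; linarith)) ((2 * d i + 4) * noiseScale κ (e i))
  rw [typeII_eq (h.Anorm_pos hi), hthr i hi, probReal_compl_eq_one_sub
    (measurableSet_lt measurable_const (measurable_quadStat hw))] at hβi
  have hexp : 3 * (1 / noiseScale κ (e i)) ^ 2 * ∑' j : ℕ+, (κ (e i) j ^ 2) ^ 2 +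
      3 / 2 * (1 / noiseScale κ (e i)) *
        meanShift (fun j => κ (e i) j ^ 2) (coeff φ (S i)) (e i) -
      1 / noiseScale κ (e i) * ((2 * d i + 4) * noiseScale κ (e i)) ≤ -1 := by
    rw [h.tsum_eq hi]
    have e1 : meanShift (fun j => κ (e i) j ^ 2) (coeff φ (S i)) (e i) =
        d i * noiseScale κ (e i) := (div_mul_cancel₀ _ hn.ne').symm
    rw [e1]
    field_simp
    linarith
  have h3 := hup.trans (Real.exp_le_exp.2 hexp)
  have h4 : Real.exp (-1) < 1 / 2 := by
    rw [Real.exp_neg, ← one_div]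
    exact one_div_lt_one_div_of_lt two_pos (by linarith [Real.add_one_lt_exp one_ne_zero])
  linarith

/-- If the shift is not o(R n), it stays above c R n along some subsequence, which is then
consistent. The smallness condition passes to all subsequences, so the converse is immediate. -/
theorem ldInconsistent_iff (hω : 0 < ω) (hφ : Orthonormal ℝ φ) {e : ℕ → ℝ}
    (he : Tendsto e atTop (𝓝[>] 0)) {S : ℕ → Signal} :
    LDInconsistent φ κ ω e S ↔ ∀ c : ℝ, 0 < c → ∀ᶠ i in atTop,
      signalShift φ κ (e i) (S i) ≤ c * (e i ^ (-2 * ω) * noiseScale κ (e i)) := by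
  constructor
  · intro hinc c hc
    by_contra hnot
    obtain ⟨n, hn, hlt⟩ := extraction_of_frequently_atTop (not_eventually.1 hnot)
    exact hinc n hn (h.ldConsistent hφ (he.comp hn.tendsto_atTop) hc
      (Eventually.of_forall fun i => (not_le.1 (hlt i)).le))
  · intro hS n hn
    exact h.not_ldConsistent hω hφ (he.comp hn.tendsto_atTop)
      fun c hc => hn.tendsto_atTop.eventually (hS c hc)

end ModerateWeights

/-! ### Weights concentrated on `k_ε` coordinates -/

/-- By monotonicity each of the coordinates 1, …, k_ε contributes at least κ_ε⁴; `Nat.succPNat`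
shifts the range to start at 1. -/
theorem kIndex_mul_kappaSq_sq_le (hκ : Summable fun j : ℕ+ => κ ε j ^ 2)
    (hanti : ∀ i j : ℕ, 1 ≤ i → i ≤ j → κ ε j ^ 2 ≤ κ ε i ^ 2) :
    (kIndex κ ε : ℝ) * kappaSq κ ε ^ 2 ≤ ∑' j : ℕ+, κ ε j ^ 4 := by
  have hsum := summable_sq_of_summable (fun _ => sq_nonneg _) hκ
  rw [← tsum_sq_sq]
  refine le_trans ?_ (hsum.sum_le_tsum ((Finset.range (kIndex κ ε)).map
    ⟨Nat.succPNat, Nat.succPNat_injective⟩) fun _ _ => sq_nonneg _)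
  rw [Finset.sum_map]
  have := Finset.card_nsmul_le_sum (Finset.range (kIndex κ ε))
    (fun i => (κ ε (Nat.succPNat i) ^ 2) ^ 2) (kappaSq κ ε ^ 2) (fun i hi => by
      refine pow_le_pow_left₀ (sq_nonneg _) ?_ 2
      exact hanti _ _ (Nat.succ_pos i) (Finset.mem_range.1 hi))
  simpa using this

/-- Since n ≥ k_ε^{1/2} κ_ε² and κ_{ε1}² = O(κ_ε²), the ratio κ_{ε1}² / n is O(k_ε^{-1/2}) =
O(ε^{2-4r-2ω}). Multiplied by R it is O(ε^{2-4r-4ω}), whose exponent is positive precisely because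
2ω < 1 - 2r. -/
theorem moderateWeights (hω' : 2 * ω < 1 - 2 * r)
    (hκ : ∀ ε : ℝ, 0 < ε → Summable fun j : ℕ+ => κ ε j ^ 2)
    (hA1 : CondA1 κ) (hA2 : CondA2 κ) (hA4 : CondA4 κ)
    (hk : (fun ε : ℝ => (kIndex κ ε : ℝ)) =Θ[𝓝[>] 0]
      fun ε : ℝ => ε ^ (-4 + 8 * r + 4 * ω)) :
    ModerateWeights κ ω := by
  have hpos : ∀ ε : ℝ, 0 < ε → 0 < ∑' j : ℕ+, κ ε j ^ 4 := by
    intro ε hε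
    obtain ⟨C₁, C₂, hC₁, hC⟩ := hA2
    have := hC₁.trans (hC ε hε).1
    exact pos_of_mul_pos_right this (by positivity)
  refine ⟨hκ, fun ε hε j => hA1 ε hε 1 j le_rfl j.pos, hpos, ?_⟩
  obtain ⟨C, hC, hCb⟩ := hA4.1.1.exists_pos
  obtain ⟨c, hc, hcb⟩ := hk.2.exists_pos
  have hlim : Tendsto (fun ε : ℝ => C * √c * ε ^ (2 - 4 * r - 4 * ω)) (𝓝[>] 0) (𝓝 0) := by
    have h1 : Tendsto (fun ε : ℝ => ε ^ (2 - 4 * r - 4 * ω)) (𝓝[>] 0) (𝓝 0) := by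
      have h2 : 0 < 2 - 4 * r - 4 * ω := by linarith
      have := (Real.continuousAt_rpow_const 0 (2 - 4 * r - 4 * ω) (Or.inr h2.le)).tendsto
      rw [Real.zero_rpow h2.ne'] at this
      exact this.mono_left nhdsWithin_le_nhds
    simpa using h1.const_mul (C * √c)
  refine squeeze_zero' ?_ ?_ hlim
  · filter_upwards [self_mem_nhdsWithin] with ε hε
    have : 0 < ε := hε
    exact mul_nonneg (by positivity) (div_nonneg (sq_nonneg _) (Real.sqrt_nonneg _))
  · filter_upwards [self_mem_nhdsWithin, hCb.bound, hcb.bound] with ε hε hb1 hb2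
    have hε' : 0 < ε := hε
    have hn : 0 < noiseScale κ ε := Real.sqrt_pos.2 (hpos ε hε')
    have hks : 0 ≤ kappaSq κ ε := sq_nonneg _
    rw [Real.norm_of_nonneg (sq_nonneg _), Real.norm_of_nonneg hks] at hb1
    rw [Real.norm_of_nonneg (by positivity), Real.norm_of_nonneg (by positivity)] at hb2
    have h1 : √(kIndex κ ε : ℝ) * kappaSq κ ε ≤ noiseScale κ ε := by
      refine Real.le_sqrt_of_sq_le ?_
      rw [mul_pow, Real.sq_sqrt (Nat.cast_nonneg _)]
      exact kIndex_mul_kappaSq_sq_le (hκ ε hε') (hA1 ε hε')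
    have h2 : ε ^ (-2 + 4 * r + 2 * ω) ≤ √c * √(kIndex κ ε : ℝ) := by
      rw [← Real.sqrt_mul hc.le]
      refine Real.le_sqrt_of_sq_le (le_trans (le_of_eq ?_) hb2)
      rw [← Real.rpow_natCast, ← Real.rpow_mul hε'.le]
      congr 1; push_cast; ring
    have h3 : ε ^ (-2 + 4 * r + 2 * ω) * κ ε 1 ^ 2 ≤ C * √c * noiseScale κ ε := by
      calc ε ^ (-2 + 4 * r + 2 * ω) * κ ε 1 ^ 2
          ≤ (√c * √(kIndex κ ε : ℝ)) * (C * kappaSq κ ε) := by gcongr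
        _ = C * √c * (√(kIndex κ ε : ℝ) * kappaSq κ ε) := by ring
        _ ≤ _ := by gcongr
    have h4 : ε ^ (-2 * ω) = ε ^ (2 - 4 * r - 4 * ω) * ε ^ (-2 + 4 * r + 2 * ω) := by
      rw [← Real.rpow_add hε']; congr 1; ring
    have h5 : 0 < ε ^ (2 - 4 * r - 4 * ω) := Real.rpow_pos_of_pos hε' _
    rw [← mul_div_assoc, div_le_iff₀ hn, h4]
    calc ε ^ (2 - 4 * r - 4 * ω) * ε ^ (-2 + 4 * r + 2 * ω) * κ ε 1 ^ 2
        = ε ^ (2 - 4 * r - 4 * ω) * (ε ^ (-2 + 4 * r + 2 * ω) * κ ε 1 ^ 2) := by ring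
      _ ≤ ε ^ (2 - 4 * r - 4 * ω) * (C * √c * noiseScale κ ε) := by gcongr
      _ = _ := by ring

/-! ### Purely consistent families -/

variable {S : ℝ → Signal}

/-- Otherwise, along a subsequence, the projection p S₁ of S onto the line of S₁ contradicts purity:
its remainder is orthogonal to it, and its norm |⟨S, S₁⟩| / ‖S₁‖ exceeds (c/b) ε^{2r}. -/
theorem ModerateWeights.isLittleO_of_purelyLDConsistent (h : ModerateWeights κ ω) (hω : 0 < ω)
    (hφ : Orthonormal ℝ φ)
    (hS : (fun ε : ℝ => ‖S ε‖) =Θ[𝓝[>] 0] fun ε : ℝ => ε ^ (2 * r))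
    (hpure : PurelyLDConsistent φ κ r ω S) {e : ℕ → ℝ} {S₁ : ℕ → Signal} (he0 : ∀ i, 0 < e i)
    (he : Tendsto e atTop (𝓝[>] 0))
    (hS₁ : (fun i => ‖S₁ i‖) =Θ[atTop] fun i => e i ^ (2 * r))
    (hinc : LDInconsistent φ κ ω e S₁) :
    (fun i => inner ℝ (S (e i)) (S₁ i)) =o[atTop] fun i => e i ^ (4 * r) := by
  rw [isLittleO_iff]
  intro c hc
  by_contra hnot
  obtain ⟨a, ha, hSa⟩ := (hS.1.comp_tendsto he).exists_pos
  obtain ⟨b, hb, hSb⟩ := hS₁.1.exists_pos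
  obtain ⟨d, hd, hSd⟩ := hS₁.2.exists_pos
  obtain ⟨n, hn, hall⟩ := extraction_of_frequently_atTop ((not_eventually.1 hnot).and_eventually
    (hSa.bound.and (hSb.bound.and hSd.bound)))
  have hp : ∀ i, 0 < e i ^ (2 * r) := fun i => Real.rpow_pos_of_pos (he0 i) _
  have hp2 : ∀ i, e i ^ (4 * r) = e i ^ (2 * r) * e i ^ (2 * r) := fun i => by
    rw [← Real.rpow_add (he0 i)]; congr 1; ring
  have hgt : ∀ i, c * (e (n i) ^ (2 * r) * e (n i) ^ (2 * r)) <
      |inner ℝ (S (e (n i))) (S₁ (n i))| := fun i => by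
    have := not_le.1 (hall i).1
    rwa [hp2, Real.norm_of_nonneg (mul_pos (hp _) (hp _)).le] at this
  have h1 : ∀ i, ‖S (e (n i))‖ ≤ a * e (n i) ^ (2 * r) := fun i => by
    have := (hall i).2.1
    simpa only [Function.comp_apply, norm_norm, Real.norm_of_nonneg (hp _).le] using this
  have h2 : ∀ i, ‖S₁ (n i)‖ ≤ b * e (n i) ^ (2 * r) := fun i => by
    have := (hall i).2.2.1
    simpa only [norm_norm, Real.norm_of_nonneg (hp _).le] using this
  have h3 : ∀ i, e (n i) ^ (2 * r) ≤ d * ‖S₁ (n i)‖ := fun i => by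
    have := (hall i).2.2.2
    simpa only [norm_norm, Real.norm_of_nonneg (hp _).le] using this
  have hne : ∀ i, 0 < ‖S₁ (n i)‖ := fun i => pos_of_mul_pos_right ((hp _).trans_le (h3 i)) hd.le
  set p : ℕ → ℝ := fun i => inner ℝ (S (e (n i))) (S₁ (n i)) / ‖S₁ (n i)‖ ^ 2 with hpdef
  refine hpure.2 ⟨e ∘ n, fun i => p i • S₁ (n i), c / b, fun i => he0 _,
    (he.comp hn.tendsto_atTop).mono_right nhdsWithin_le_nhds, ?_, ?_, by positivity, ?_⟩
  · have hpb : ∀ i, p i ^ 2 ≤ (a * d) ^ 2 := by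
      intro i
      refine sq_le_sq.2 ?_
      rw [abs_of_pos (mul_pos ha hd), hpdef, abs_div, abs_of_pos (pow_pos (hne i) 2),
        div_le_iff₀ (pow_pos (hne i) 2)]
      calc |inner ℝ (S (e (n i))) (S₁ (n i))| ≤ ‖S (e (n i))‖ * ‖S₁ (n i)‖ :=
            abs_real_inner_le_norm _ _
        _ ≤ (a * (d * ‖S₁ (n i)‖)) * ‖S₁ (n i)‖ := by
            gcongr
            exact (h1 i).trans (mul_le_mul_of_nonneg_left (h3 i) ha.le)
        _ = _ := by ring
    refine (h.ldInconsistent_iff hω hφ (he.comp hn.tendsto_atTop)).2 fun t ht => ?_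
    have hev := (h.ldInconsistent_iff hω hφ he).1 hinc (t / (a * d) ^ 2) (by positivity)
    filter_upwards [hn.tendsto_atTop.eventually hev] with i hi
    rw [signalShift_smul]
    refine (mul_le_mul (hpb i) hi signalShift_nonneg (sq_nonneg _)).trans (le_of_eq ?_)
    simp only [Function.comp_apply]
    field_simp
  · intro i
    simp only [Function.comp_apply]
    rw [inner_sub_right, real_inner_smul_left, real_inner_smul_left, real_inner_smul_right,
      real_inner_self_eq_norm_sq, real_inner_comm, hpdef, div_mul_cancel₀ _ (pow_pos (hne i) 2).ne',
      sub_self]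
  · intro i
    rw [norm_smul, Real.norm_eq_abs, hpdef, abs_div, abs_of_pos (pow_pos (hne i) 2), sq,
      ← div_div, div_mul_cancel₀ _ (hne i).ne', lt_div_iff₀ (hne i)]
    refine lt_of_le_of_lt ?_ (hgt i)
    calc c / b * (e ∘ n) i ^ (2 * r) * ‖S₁ (n i)‖
        ≤ c / b * e (n i) ^ (2 * r) * (b * e (n i) ^ (2 * r)) := by
          have := hp (n i)
          exact mul_le_mul_of_nonneg_left (h2 i) (by positivity)
      _ = _ := by field_simp

theorem ModerateWeights.purelyLDConsistent (h : ModerateWeights κ ω) (hω : 0 < ω)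
    (hφ : Orthonormal ℝ φ)
    (hS : (fun ε : ℝ => ‖S ε‖) =Θ[𝓝[>] 0] fun ε : ℝ => ε ^ (2 * r))
    (horth : ∀ (e : ℕ → ℝ) (S₁ : ℕ → Signal), (∀ i, 0 < e i) → Tendsto e atTop (𝓝[>] 0) →
      ((fun i => ‖S₁ i‖) =Θ[atTop] fun i => e i ^ (2 * r)) → LDInconsistent φ κ ω e S₁ →
      (fun i => inner ℝ (S (e i)) (S₁ i)) =o[atTop] fun i => e i ^ (4 * r)) :
    PurelyLDConsistent φ κ r ω S := by
  -- Both halves of purity reduce to this claim. The relation ⟨S, S₁⟩ = ‖S₁‖² gives ‖S₁‖ ≤ ‖S‖, so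
  -- the norm of S₁ has exact order ε^{2r} and `horth` applies, forcing ‖S₁‖² = o(ε^{4r}).
  have hnot : ∀ (e : ℕ → ℝ) (S₁ : ℕ → Signal) (c : ℝ), (∀ i, 0 < e i) →
      Tendsto e atTop (𝓝[>] 0) → LDInconsistent φ κ ω e S₁ →
      (∀ i, inner ℝ (S (e i)) (S₁ i) = ‖S₁ i‖ ^ 2) → 0 < c →
      ¬ ∀ᶠ i in atTop, c * e i ^ (2 * r) ≤ ‖S₁ i‖ := by
    intro e S₁ c he0 he hinc hin hc hle
    have hp : ∀ i, 0 < e i ^ (2 * r) := fun i => Real.rpow_pos_of_pos (he0 i) _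
    have hbig : (fun i => e i ^ (2 * r)) =O[atTop] fun i => ‖S₁ i‖ := by
      refine IsBigO.of_bound c⁻¹ ?_
      filter_upwards [hle] with i hi
      rw [Real.norm_of_nonneg (hp i).le, norm_norm, inv_mul_eq_div, le_div_iff₀' hc]
      exact hi
    have hle' : (fun i => ‖S₁ i‖) =O[atTop] fun i => e i ^ (2 * r) := by
      refine (IsBigO.of_bound 1 (Eventually.of_forall fun i => ?_)).trans (hS.1.comp_tendsto he)
      rw [Function.comp_apply, norm_norm, norm_norm, one_mul]
      rcases eq_or_ne (S₁ i) 0 with h0 | h0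
      · simp [h0]
      · have h1 := real_inner_le_norm (S (e i)) (S₁ i)
        rw [hin i, sq] at h1
        exact le_of_mul_le_mul_right h1 (norm_pos_iff.2 h0)
    have ho := (horth e S₁ he0 he ⟨hle', hbig⟩ hinc).bound
      (show 0 < c ^ 2 / 2 by positivity)
    obtain ⟨i, hi1, hi2⟩ := (ho.and hle).exists
    rw [hin, Real.norm_of_nonneg (sq_nonneg _),
      show e i ^ (4 * r) = (e i ^ (2 * r)) ^ 2 by
        rw [← Real.rpow_natCast, ← Real.rpow_mul (he0 i).le]; congr 1; push_cast; ring,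
      Real.norm_of_nonneg (sq_nonneg _)] at hi1
    have h2 := pow_le_pow_left₀ (mul_pos hc (hp i)).le hi2 2
    rw [mul_pow] at h2
    have : 0 < c ^ 2 * (e i ^ (2 * r)) ^ 2 := by have := hp i; positivity
    linarith
  refine ⟨?_, ?_⟩
  · by_contra hcons
    -- If S is not consistent, no constant c = 1/(k+1) works in the criterion; choosing one noise
    -- level for each k yields a sequence along which S itself is inconsistent.
    have hfreq : ∀ k : ℕ, ∃ ε : ℝ, 0 < ε ∧ ε < 1 / ((k : ℝ) + 1) ∧ signalShift φ κ ε (S ε) <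
        1 / ((k : ℝ) + 1) * (ε ^ (-2 * ω) * noiseScale κ ε) := by
      intro k
      have hk : (0 : ℝ) < 1 / ((k : ℝ) + 1) := Nat.one_div_pos_of_nat
      have hfr : ∃ᶠ ε : ℝ in 𝓝[>] 0, ¬ 1 / ((k : ℝ) + 1) * (ε ^ (-2 * ω) * noiseScale κ ε) ≤
          signalShift φ κ ε (S ε) :=
        fun hev => hcons (h.ldConsistent hφ (e := id) tendsto_id hk (by simpa using hev))
      obtain ⟨ε, hε, h0, h1⟩ := (hfr.and_eventually (Ioo_mem_nhdsGT hk)).exists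
      exact ⟨ε, h0, h1, not_le.1 hε⟩
    choose e he0 he1 hlt using hfreq
    have he : Tendsto e atTop (𝓝[>] 0) := tendsto_nhdsWithin_iff.2
      ⟨squeeze_zero (fun k => (he0 k).le) (fun k => (he1 k).le)
        tendsto_one_div_add_atTop_nhds_zero_nat, Eventually.of_forall he0⟩
    have hinc : LDInconsistent φ κ ω e (S ∘ e) := by
      refine (h.ldInconsistent_iff hω hφ he).2 fun c hc => ?_
      filter_upwards [(tendsto_one_div_add_atTop_nhds_zero_nat (𝕜 := ℝ)).eventually_lt_const hc]
        with k hk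
      refine (hlt k).le.trans (mul_le_mul_of_nonneg_right hk.le ?_)
      exact mul_nonneg (Real.rpow_nonneg (he0 k).le _) (h.noiseScale_pos (he0 k)).le
    obtain ⟨d, hd, hSd⟩ := (hS.2.comp_tendsto he).exists_pos
    refine hnot e (S ∘ e) d⁻¹ he0 he hinc (fun i => real_inner_self_eq_norm_sq _)
      (inv_pos.2 hd) ?_
    filter_upwards [hSd.bound] with i hi
    rw [inv_mul_eq_div, div_le_iff₀' hd]
    simpa only [Function.comp_apply, norm_norm,
      Real.norm_of_nonneg (Real.rpow_pos_of_pos (he0 i) (2 * r)).le] using hi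
  · rintro ⟨e, S₁, c, he0, he, hinc, hort, hc, hle⟩
    refine hnot e S₁ c he0 (tendsto_nhdsWithin_iff.2 ⟨he, Eventually.of_forall he0⟩) hinc
      (fun i => ?_) hc (Eventually.of_forall fun i => (hle i).le)
    have := hort i
    rw [inner_sub_right, real_inner_self_eq_norm_sq, sub_eq_zero, real_inner_comm] at this
    exact this

end SignalDetection

theorem mainTheorem6
    (r ω : ℝ) (hr : 0 < r) (hr' : r < 1 / 2) (hω : 0 < ω) (hω' : 2 * ω < 1 - 2 * r)
    (φ : ℕ+ → Signal) (hφ : Orthonormal ℝ φ)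
    (κ : ℝ → ℕ → ℝ) (hκ : ∀ ε : ℝ, 0 < ε → Summable fun j : ℕ+ => κ ε j ^ 2)
    (hA1 : CondA1 κ) (hA2 : CondA2 κ) (hA3 : CondA3 κ) (hA4 : CondA4 κ)
    (hk : (fun ε : ℝ => (kIndex κ ε : ℝ)) =Θ[𝓝[>] 0]
      fun ε : ℝ => ε ^ (-4 + 8 * r + 4 * ω))
    (S : ℝ → Signal)
    (hS : (fun ε : ℝ => ‖S ε‖) =Θ[𝓝[>] 0] fun ε : ℝ => ε ^ (2 * r)) :
    PurelyLDConsistent φ κ r ω S ↔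
      ∀ (e : ℕ → ℝ) (S₁ : ℕ → Signal), (∀ i, 0 < e i) → Tendsto e atTop (𝓝 0) →
        ((fun i => ‖S₁ i‖) =Θ[atTop] fun i => e i ^ (2 * r)) →
        LDInconsistent φ κ ω e S₁ →
        (fun i => ‖S (e i) + S₁ i‖ ^ 2 - (‖S (e i)‖ ^ 2 + ‖S₁ i‖ ^ 2))
          =o[atTop] fun i => e i ^ (4 * r) := by
  have h : ModerateWeights κ ω := moderateWeights hω' hκ hA1 hA2 hA4 hk
  have hcross : ∀ (e : ℕ → ℝ) (S₁ : ℕ → Signal),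
      (fun i => ‖S (e i) + S₁ i‖ ^ 2 - (‖S (e i)‖ ^ 2 + ‖S₁ i‖ ^ 2)) =
        fun i => 2 * inner ℝ (S (e i)) (S₁ i) := by
    intro e S₁
    funext i
    rw [norm_add_sq_real]
    ring
  constructor
  · intro hpure e S₁ he0 he hS₁ hinc
    rw [hcross]
    exact (h.isLittleO_of_purelyLDConsistent hω hφ hS hpure he0
      (tendsto_nhdsWithin_iff.2 ⟨he, Eventually.of_forall he0⟩) hS₁ hinc).const_mul_left 2
  · intro hall
    refine h.purelyLDConsistent hω hφ hS fun e S₁ he0 he hS₁ hinc => ?_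
    have := hall e S₁ he0 (he.mono_right nhdsWithin_le_nhds) hS₁ hinc
    rw [hcross] at this
    exact (isLittleO_const_mul_left_iff two_ne_zero).1 this
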